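/- Call a group $M$ metabelian if its commutator subgroup is contained in its center, and indecomposable if it is nontrivial and is not the direct product of two nontrivial subgroups. For a finite abelian group $B$ and a subgroup $A\subseteq B$ of exponent $m$, let $G(A\subseteq B)=(A\oplus B)\rtimes_\psi \mathbb Z/m$ with $\psi(d)(a,b)=(a,b+da)$. Let $\mathcal S(\mathbb Z/p^n)$ denote the category of embeddings $(A\subseteq B)$ of a subgroup $A$ in a finite abelian group $B$ with $p^nB=0$. Let $p$ be a prime. (1) There are at least $p$ indecomposable, pairwise nonisomorphic metabelian groups of order $p^{31}$ and exponent $p^7$ such that the exponent of the commutator subgroup is $p^3$. They can be chosen among the groups $G(A_\lambda\subseteq B)$, $0\le\lambda<p$, where $(A_\lambda\subseteq B)$ in $\mathcal S(\mathbb Z/p^7)$ is the following embedding: $B$ is the direct sum of cyclic groups with generators $x_1,x_2,y_1,y_2,z$ of orders $p^7,p^6,p^4,p^3,p$, and $A_\lambda$ is generated by $p^4x_1+py_2+z$, $p^3x_2+p^2y_1+z$ and $p^3y_1+\lambda p^2y_2$. (2) There are at least $\binom p2$ indecomposable, pairwise nonisomorphic metabelian groups of order $p^{60}$ and exponent $p^8$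 such that the exponent of the commutator subgroup is $p^3$. They can be chosen among the groups $G(C_{\lambda,\mu}\subseteq D)$, $0\le\lambda<\mu<p$, where $(C_{\lambda,\mu}\subseteq D)$ in $\mathcal S(\mathbb Z/p^8)$ is the following embedding: $D$ is the direct sum of cyclic groups with generators $x_1,x_2,x_3,x_4,y_1,y_2,y_3,y_4,z_1,z_2$ of orders $p^8,p^7,p^6,p^6,p^4,p^4,p^3,p^3,p,p$, and $C_{\lambda,\mu}$ is generated by $p^5x_1+p^4x_2+py_3+z_1$, $p^4x_2+py_4+z_2$, $p^3x_3+p^2y_1+z_1$, $p^3x_4+p^2y_2+z_2$, $p^3y_1+\lambda p^2y_3$ and $p^3y_2+\mu p^2y_4$. -/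

import Mathlib

/-! ## Semidirect products attached to subgroup embeddings -/

/-- The biadditive pairing `ℤ/m × A → B`, `(d, a) ↦ d ι(a)`, where `m` is the exponent of the
subgroup `A` of `B` and `ι : A → B` is the inclusion. -/
noncomputable def embPairing {B : Type} [AddCommGroup B] (A : AddSubgroup B) :
    ZMod (AddMonoid.exponent A) →+ (A →+ B) :=
  ZMod.lift (AddMonoid.exponent A) ⟨zmultiplesHom (A →+ B) A.subtype, by
    ext a
    have h := congrArg A.subtype (AddMonoid.exponent_nsmul_eq_zero (G := A) a)
    simpa using h⟩

/-- The automorphism `ψ(d) : (a, b) ↦ (a, b + d ι(a))` of `A ⊕ B`. -/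
noncomputable def embShear {B : Type} [AddCommGroup B] (A : AddSubgroup B)
    (d : ZMod (AddMonoid.exponent A)) : A × B ≃+ A × B where
  toFun x := (x.1, x.2 + embPairing A d x.1)
  invFun x := (x.1, x.2 - embPairing A d x.1)
  left_inv x := by simp
  right_inv x := by simp
  map_add' x y := by
    ext
    · simp
    · simp only [Prod.fst_add, Prod.snd_add, map_add]
      abel

/-- The homomorphism `ψ : ℤ/m → Aut(A ⊕ B)`, in multiplicative notation. -/
noncomputable def embAction {B : Type} [AddCommGroup B] (A : AddSubgroup B) :
    Multiplicative (ZMod (AddMonoid.exponent A)) →* MulAut (Multiplicative (A × B)) where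
  toFun d := AddEquiv.toMultiplicative (embShear A d.toAdd)
  map_one' := by
    refine MulEquiv.ext fun x => Multiplicative.toAdd.injective ?_
    ext1 <;> simp [embShear]
  map_mul' c d := by
    refine MulEquiv.ext fun x => Multiplicative.toAdd.injective ?_
    ext1
    · simp [embShear]
    · simp [embShear]
      abel

/-- The group `G(A ⊆ B) = (A ⊕ B) ⋊ ℤ/m`, where `m` is the exponent of `A`. -/
abbrev EmbGroup {B : Type} [AddCommGroup B] (A : AddSubgroup B) : Type :=
  Multiplicative (A × B) ⋊[embAction A] Multiplicative (ZMod (AddMonoid.exponent A))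

/-- `(A ⊆ B)` is an object of `S(ℤ/p^n)`: the abelian group `B` is finite and `p^n`-bounded. -/
structure IsEmbeddingObject (p n : ℕ) {B : Type} [AddCommGroup B] (_A : AddSubgroup B) :
    Prop where
  finite : Finite B
  bounded : ∀ b : B, p ^ n • b = 0

/-! ## The two explicit families of embeddings -/

/-- The abelian group `ℤ/p^(e 0) ⊕ ℤ/p^(e 1) ⊕ ⋯`. -/
abbrev CyclicSum (p : ℕ) {k : ℕ} (e : Fin k → ℕ) : Type :=
  ∀ i : Fin k, ZMod (p ^ e i)

/-- The element of `CyclicSum p e` with the given integer coordinates. -/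
def CyclicSum.mk (p : ℕ) {k : ℕ} (e : Fin k → ℕ) (c : Fin k → ℕ) : CyclicSum p e :=
  fun i => (c i : ZMod (p ^ e i))

/-- `B` has generators `x₁, x₂, y₁, y₂, z` of order `p^7, p^6, p^4, p^3, p`. -/
def expB : Fin 5 → ℕ := ![7, 6, 4, 3, 1]

/-- The subgroup `A_l` of `B`, generated by
`p^4 x₁ + p y₂ + z`, `p^3 x₂ + p^2 y₁ + z` and `p^3 y₁ + l p^2 y₂`. -/
def subA (p l : ℕ) : AddSubgroup (CyclicSum p expB) :=
  AddSubgroup.closure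
    { CyclicSum.mk p expB ![p ^ 4, 0, 0, p, 1],
      CyclicSum.mk p expB ![0, p ^ 3, p ^ 2, 0, 1],
      CyclicSum.mk p expB ![0, 0, p ^ 3, l * p ^ 2, 0] }

/-- `D` has generators `x₁, x₂, x₃, x₄, y₁, y₂, y₃, y₄, z₁, z₂` of order
`p^8, p^7, p^6, p^6, p^4, p^4, p^3, p^3, p, p`. -/
def expD : Fin 10 → ℕ := ![8, 7, 6, 6, 4, 4, 3, 3, 1, 1]

/-- The subgroup `C_{l,m}` of `D`, generated by
`p^5 x₁ + p^4 x₂ + p y₃ + z₁`, `p^4 x₂ + p y₄ + z₂`,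
`p^3 x₃ + p^2 y₁ + z₁`, `p^3 x₄ + p^2 y₂ + z₂`,
`p^3 y₁ + l p^2 y₃` and `p^3 y₂ + m p^2 y₄`. -/
def subC (p l m : ℕ) : AddSubgroup (CyclicSum p expD) :=
  AddSubgroup.closure
    { CyclicSum.mk p expD ![p ^ 5, p ^ 4, 0, 0, 0, 0, p, 0, 1, 0],
      CyclicSum.mk p expD ![0, p ^ 4, 0, 0, 0, 0, 0, p, 0, 1],
      CyclicSum.mk p expD ![0, 0, p ^ 3, 0, p ^ 2, 0, 0, 0, 1, 0],
      CyclicSum.mk p expD ![0, 0, 0, p ^ 3, 0, p ^ 2, 0, 0, 0, 1],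
      CyclicSum.mk p expD ![0, 0, 0, 0, p ^ 3, 0, l * p ^ 2, 0, 0, 0],
      CyclicSum.mk p expD ![0, 0, 0, 0, 0, p ^ 3, 0, m * p ^ 2, 0, 0] }

/-! ## Properties of groups -/

/-- Metabelian in the sense of Birkhoff: the commutator subgroup lies in the center. -/
def IsBirkhoffMetabelian (M : Type) [Group M] : Prop :=
  commutator M ≤ Subgroup.center M

/-- A group is indecomposable if it is nontrivial and not the internal direct product of two
nontrivial (normal) subgroups. -/
def IsIndecomposableGroup (M : Type) [Group M] : Prop :=
  Nontrivial M ∧ ∀ H K : Subgroup M, H.Normal → K.Normal → IsCompl H K → H = ⊥ ∨ K = ⊥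

/-- There are at least `N` pairwise nonisomorphic groups with property `P`. -/
def AtLeastNonisomorphic (N : ℕ) (P : (M : Type) → [Group M] → Prop) : Prop :=
  ∃ (M : Fin N → Type) (_ : ∀ i, Group (M i)),
    (∀ i, P (M i)) ∧ ∀ i j, i ≠ j → IsEmpty (M i ≃* M j)

/-!
In `G = G(A ⊆ B)` the center is `B` and the commutator subgroup is `A`, so the embedding `A ⊆ B` can
be read off from the group: an isomorphism of groups induces an isomorphism of embeddings
(`EmbGroup.exists_homs_of_mulEquiv`), and the projections of a direct decomposition `G = H × K`
induce complementary idempotents of `B` that preserve `A`. If one of these idempotents is zero, then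
`H` or `K` meets the center trivially, and is trivial because `G` has class two. It remains to see
that the embeddings `A_l ⊆ B` and `C_{l,m} ⊆ D` are indecomposable and pairwise nonisomorphic.

An endomorphism `f` of a direct sum of cyclic `p`-groups has an integral matrix whose `(i, j)` entry
is divisible by `p ^ (e i - e j)`; dividing by this power and reducing modulo `p` gives the
coefficients `homCoeff f i j`. The blocks between generators of the same order are multiplicative
(`homCoeff_comp`), and an idempotent whose blocks all vanish is zero (`eq_zero_of_comp_self`).

That `f` maps `A_l` into `A_l'` is expressed by integral coefficients for the images of the
generators. Comparing the terms of lowest order in each coordinate (`leading_coeff`) forces all five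
diagonal coefficients of `f` to have the same residue `c`, with `l c = l' c` modulo `p`
(`homCoeff_of_map_subA`). For an isomorphism `c ≠ 0`, whence `l = l'`; for idempotents `f`, `g` with
`f g = 0` the product of their residues is zero, so one of them has `c = 0` and vanishes.

For `C_{l,m}` the residue `c` is replaced by a `2 × 2`-matrix `N` over `ℤ/p` with
`diag(l', m') N = N diag(l, m)` (`homCoeff_of_map_subC`). An isomorphism has `N` invertible, which
forces `{l, m} = {l', m'}`. For an endomorphism, `l ≠ m` makes `N` diagonal; the summand `p⁴ x₂`
shared by the first two generators forces its column sums to be equal, so `N` is scalar, and the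
argument for `A_l` applies.
-/

open scoped commutatorElement

/-! ### Calculus in the group `G(A ⊆ B)` -/

section EmbGroup

variable {B : Type} [AddCommGroup B] (A : AddSubgroup B)

/-- The element `(a, b, d)` of `G(A ⊆ B) = (A ⊕ B) ⋊ ℤ/m`. -/
def EmbGroup.mk (a : A) (b : B) (d : ZMod (AddMonoid.exponent A)) : EmbGroup A :=
  ⟨Multiplicative.ofAdd (a, b), Multiplicative.ofAdd d⟩

namespace EmbGroup

variable {A}

theorem exists_eq_mk (x : EmbGroup A) : ∃ a b d, x = mk A a b d :=
  ⟨x.left.toAdd.1, x.left.toAdd.2, x.right.toAdd, rfl⟩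

theorem mk_inj {a a' : A} {b b' : B} {d d' : ZMod (AddMonoid.exponent A)} :
    mk A a b d = mk A a' b' d' ↔ a = a' ∧ b = b' ∧ d = d' := by
  constructor
  · intro h
    have h1 : (a, b) = (a', b') := congrArg (fun x : EmbGroup A => x.left.toAdd) h
    have h2 : d = d' := congrArg (fun x : EmbGroup A => x.right.toAdd) h
    exact ⟨congrArg Prod.fst h1, congrArg Prod.snd h1, h2⟩
  · rintro ⟨rfl, rfl, rfl⟩
    rfl

theorem one_eq_mk : (1 : EmbGroup A) = mk A 0 0 0 := rfl

theorem mk_mul_mk (a a' : A) (b b' : B) (d d' : ZMod (AddMonoid.exponent A)) :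
    mk A a b d * mk A a' b' d' = mk A (a + a') (b + (b' + embPairing A d a')) (d + d') := rfl

theorem embPairing_intCast (n : ℤ) (a : A) : embPairing A (n : ZMod _) a = n • (a : B) := by
  simp [embPairing]

theorem embPairing_one (a : A) : embPairing A 1 a = a := by
  simpa using embPairing_intCast 1 a

theorem embPairing_mem (d : ZMod (AddMonoid.exponent A)) (a : A) : embPairing A d a ∈ A := by
  obtain ⟨n, rfl⟩ := ZMod.intCast_surjective d
  rw [embPairing_intCast]
  exact A.zsmul_mem a.2 n

theorem eq_zero_of_embPairing_eq_zero {d : ZMod (AddMonoid.exponent A)}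
    (h : ∀ a : A, embPairing A d a = 0) : d = 0 := by
  obtain ⟨n, rfl⟩ := ZMod.intCast_surjective d
  rw [ZMod.intCast_zmod_eq_zero_iff_dvd, Int.natCast_dvd,
    AddMonoid.exponent_dvd_iff_forall_nsmul_eq_zero]
  intro a
  have h1 : n • a = 0 := by
    ext
    simpa [embPairing_intCast] using h a
  rcases Int.natAbs_eq n with hn | hn
  · rwa [hn, natCast_zsmul] at h1
  · rwa [hn, neg_zsmul, neg_eq_zero, natCast_zsmul] at h1

theorem mk_mul_comm_iff (a a' : A) (b b' : B) (d d' : ZMod (AddMonoid.exponent A)) :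
    mk A a b d * mk A a' b' d' = mk A a' b' d' * mk A a b d ↔
      embPairing A d a' = embPairing A d' a := by
  rw [mk_mul_mk, mk_mul_mk, mk_inj]
  constructor
  · rintro ⟨-, h, -⟩
    rwa [← add_assoc, ← add_assoc, add_comm b', add_right_inj] at h
  · intro h
    refine ⟨add_comm _ _, ?_, add_comm _ _⟩
    rw [h]
    abel

/-- The inclusion `b ↦ (0, b, 0)` of `B` into `G(A ⊆ B)`. -/
noncomputable def incl (A : AddSubgroup B) : Multiplicative B →* EmbGroup A :=
  SemidirectProduct.inl.comp (AddMonoidHom.toMultiplicative (AddMonoidHom.inr A B))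

theorem incl_ofAdd (b : B) : incl A (Multiplicative.ofAdd b) = mk A 0 b 0 := rfl

theorem incl_injective : Function.Injective (incl A) := by
  intro x y h
  exact (mk_inj.1 h).2.1

/-- The center of `G(A ⊆ B)` is `B`. -/
theorem mem_center_iff {x : EmbGroup A} :
    x ∈ Subgroup.center (EmbGroup A) ↔ ∃ b : B, incl A (Multiplicative.ofAdd b) = x := by
  rw [Subgroup.mem_center_iff]
  constructor
  · intro h
    obtain ⟨a, b, d, rfl⟩ := exists_eq_mk x
    have h1 := fun a' => (mk_mul_comm_iff _ _ _ _ _ _).1 (h (mk A a' 0 0))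
    have h2 := (mk_mul_comm_iff _ _ _ _ _ _).1 (h (mk A 0 0 1))
    have hd : d = 0 := eq_zero_of_embPairing_eq_zero fun a' => by
      simpa using (h1 a').symm
    have ha : a = 0 := by
      rw [embPairing_one, map_zero] at h2
      exact Subtype.ext h2
    exact ⟨b, by rw [incl_ofAdd, ha, hd]⟩
  · rintro ⟨b, rfl⟩ y
    obtain ⟨a', b', d', rfl⟩ := exists_eq_mk y
    rw [incl_ofAdd, mk_mul_comm_iff]
    simp

/-- The commutator subgroup of `G(A ⊆ B)` is `A`, seen inside the center `B`. -/
theorem commutator_eq_map :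
    commutator (EmbGroup A) = (AddSubgroup.toSubgroup A).map (incl A) := by
  apply le_antisymm
  · rw [commutator_def, Subgroup.commutator_le]
    intro x _ y _
    obtain ⟨a, b, d, rfl⟩ := exists_eq_mk x
    obtain ⟨a', b', d', rfl⟩ := exists_eq_mk y
    refine ⟨Multiplicative.ofAdd (embPairing A d a' - embPairing A d' a),
      A.sub_mem (embPairing_mem d a') (embPairing_mem d' a), ?_⟩
    rw [commutatorElement_def, mul_assoc, ← mul_inv_rev, eq_mul_inv_iff_mul_eq, incl_ofAdd,
      mk_mul_mk, mk_mul_mk, mk_mul_mk, mk_inj]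
    refine ⟨by abel, ?_, by abel⟩
    simp only [map_zero, AddMonoidHom.zero_apply]
    abel
  · suffices key : ∀ b ∈ A, incl A (Multiplicative.ofAdd b) ∈ commutator (EmbGroup A) by
      rintro _ ⟨x, hx, rfl⟩
      exact key x.toAdd hx
    intro b hb
    have h : incl A (Multiplicative.ofAdd b) = ⁅mk A 0 0 1, mk A ⟨b, hb⟩ 0 0⁆ := by
      rw [commutatorElement_def, mul_assoc, ← mul_inv_rev, eq_mul_inv_iff_mul_eq, incl_ofAdd,
        mk_mul_mk, mk_mul_mk, mk_mul_mk, mk_inj]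
      simp [embPairing_one]
    rw [h, commutator_def]
    exact Subgroup.commutator_mem_commutator (Subgroup.mem_top _) (Subgroup.mem_top _)

theorem incl_mem_commutator_iff {b : B} :
    incl A (Multiplicative.ofAdd b) ∈ commutator (EmbGroup A) ↔ b ∈ A := by
  rw [commutator_eq_map, Subgroup.mem_map_iff_mem incl_injective]
  rfl

theorem isBirkhoffMetabelian (A : AddSubgroup B) : IsBirkhoffMetabelian (EmbGroup A) := by
  intro x hx
  rw [commutator_eq_map] at hx
  obtain ⟨b, -, rfl⟩ := hx
  exact mem_center_iff.2 ⟨b.toAdd, rfl⟩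

theorem exponent_commutator (A : AddSubgroup B) :
    Monoid.exponent (commutator (EmbGroup A)) = AddMonoid.exponent A := by
  rw [commutator_eq_map,
    ← Monoid.exponent_eq_of_mulEquiv (Subgroup.equivMapOfInjective _ _ (incl_injective (A := A)))]
  exact Monoid.exponent_multiplicative (G := A)

theorem natCard_eq (A : AddSubgroup B) :
    Nat.card (EmbGroup A) = Nat.card A * Nat.card B * AddMonoid.exponent A := by
  have h1 : Nat.card (Multiplicative (A × B)) = Nat.card A * Nat.card B := Nat.card_prod _ _
  have h2 : Nat.card (Multiplicative (ZMod (AddMonoid.exponent A))) = AddMonoid.exponent A :=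
    Nat.card_zmod _
  rw [SemidirectProduct.card, h1, h2]

theorem mk_pow (a : A) (b : B) (d : ZMod (AddMonoid.exponent A)) (n : ℕ) :
    mk A a b d ^ n = mk A (n • a) (n • b + n.choose 2 • embPairing A d a) (n • d) := by
  induction n with
  | zero => simp [one_eq_mk]
  | succ n ih =>
    rw [pow_succ, ih, mk_mul_mk, mk_inj]
    refine ⟨(succ_nsmul _ _).symm, ?_, (succ_nsmul _ _).symm⟩
    rw [Nat.choose_succ_succ' n 1, Nat.choose_one_right, map_nsmul, AddMonoidHom.nsmul_apply,
      succ_nsmul, add_nsmul]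
    abel

/-- As `(a, b, d)ⁿ = (na, nb + (n choose 2) d a, nd)`, the group `G(A ⊆ B)` has the exponent of `B`
as soon as the exponent of `A` divides the binomial coefficient. -/
theorem exponent_eq {A : AddSubgroup B} {n : ℕ} (hB : AddMonoid.exponent B = n)
    (hA : AddMonoid.exponent A ∣ n) (hA' : AddMonoid.exponent A ∣ n.choose 2) :
    Monoid.exponent (EmbGroup A) = n := by
  apply Nat.dvd_antisymm
  · rw [Monoid.exponent_dvd_iff_forall_pow_eq_one]
    intro x
    obtain ⟨a, b, d, rfl⟩ := exists_eq_mk x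
    have h1 : ∀ {k : ℕ}, AddMonoid.exponent A ∣ k → ∀ a : A, k • a = 0 :=
      fun h => AddMonoid.exponent_dvd_iff_forall_nsmul_eq_zero.1 h
    have h2 : n • b = 0 := AddMonoid.exponent_dvd_iff_forall_nsmul_eq_zero.1 hB.dvd b
    have h3 : n • d = 0 := by
      rw [nsmul_eq_mul, (ZMod.natCast_eq_zero_iff _ _).2 hA, zero_mul]
    have h4 : n.choose 2 • embPairing A d a = 0 := by
      rw [← map_nsmul, h1 hA', map_zero]
    rw [mk_pow, h1 hA, h2, h3, h4, add_zero, one_eq_mk]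
  · rw [← hB, ← Monoid.exponent_multiplicative]
    exact Monoid.exponent_dvd_of_monoidHom (incl A) incl_injective

/-! ### From groups back to embeddings -/

/-- A homomorphism between groups `G(A ⊆ B)` that maps center to center induces a homomorphism
between the groups `B`. -/
theorem exists_hom_of_map_center {B' : Type} [AddCommGroup B'] {A' : AddSubgroup B'}
    (φ : EmbGroup A →* EmbGroup A')
    (hφ : ∀ x ∈ Subgroup.center (EmbGroup A), φ x ∈ Subgroup.center (EmbGroup A')) :
    ∃ f : B →+ B', (∀ b, incl A' (Multiplicative.ofAdd (f b)) = φ (incl A (Multiplicative.ofAdd b)))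
      ∧ ∀ a ∈ A, f a ∈ A' := by
  choose f hf using fun b => mem_center_iff.1 (hφ _ (mem_center_iff.2 ⟨b, rfl⟩))
  refine ⟨AddMonoidHom.mk' f fun b c => ?_, hf, fun a ha => ?_⟩
  · apply Multiplicative.ofAdd.injective
    apply incl_injective (A := A')
    rw [hf, ofAdd_add, ofAdd_add, map_mul, map_mul, map_mul, hf, hf]
  · have h1 : φ (incl A (Multiplicative.ofAdd a)) ∈ (commutator (EmbGroup A)).map φ :=
      ⟨_, incl_mem_commutator_iff.2 ha, rfl⟩
    rw [← hf, commutator_def, Subgroup.map_commutator] at h1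
    apply incl_mem_commutator_iff.1
    rw [commutator_def]
    exact Subgroup.commutator_mono le_top le_top h1

/-- Isomorphic groups `G(A ⊆ B)` come from isomorphic embeddings. -/
theorem exists_homs_of_mulEquiv {B' : Type} [AddCommGroup B'] {A' : AddSubgroup B'}
    (φ : EmbGroup A ≃* EmbGroup A') :
    ∃ (f : B →+ B') (g : B' →+ B), g.comp f = AddMonoidHom.id B ∧
      (∀ a ∈ A, f a ∈ A') ∧ ∀ a ∈ A', g a ∈ A := by
  have key : ∀ {B B' : Type} [AddCommGroup B] [AddCommGroup B'] {A : AddSubgroup B}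
      {A' : AddSubgroup B'} (φ : EmbGroup A ≃* EmbGroup A'),
      ∀ x ∈ Subgroup.center (EmbGroup A), φ x ∈ Subgroup.center (EmbGroup A') := by
    intro B B' _ _ A A' φ x hx
    rw [Subgroup.mem_center_iff] at hx ⊢
    intro y
    obtain ⟨y, rfl⟩ := φ.surjective y
    rw [← map_mul, hx, map_mul]
  obtain ⟨f, hf, hfA⟩ := exists_hom_of_map_center φ.toMonoidHom (key φ)
  obtain ⟨g, hg, hgA⟩ := exists_hom_of_map_center φ.symm.toMonoidHom (key φ.symm)
  refine ⟨f, g, ?_, hfA, hgA⟩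
  ext b
  apply Multiplicative.ofAdd.injective
  apply incl_injective (A := A)
  have h1 := hg (f b)
  rw [hf] at h1
  exact h1.trans (φ.symm_apply_apply _)

end EmbGroup

/-- The projections of an internal direct product `G = H × K`. -/
theorem exists_projections_of_isCompl {G : Type*} [Group G] {H K : Subgroup G} (hH : H.Normal)
    (hK : K.Normal) (h : IsCompl H K) :
    ∃ φ ψ : G →* G, (∀ x, φ x ∈ H) ∧ (∀ x, ψ x ∈ K) ∧ (∀ x, φ x * ψ x = x) ∧
      (∀ x ∈ H, φ x = x) ∧ (∀ x ∈ K, ψ x = x) ∧ (∀ x, φ (ψ x) = 1) := by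
  have hc := Subgroup.commute_of_normal_of_disjoint H K hH hK h.disjoint
  let μ : H × K →* G := MonoidHom.noncommCoprod H.subtype K.subtype
    fun m n => hc m n m.2 n.2
  have hμ : ∀ x : H × K, μ x = x.1 * x.2 := fun x => rfl
  have hinj : Function.Injective μ := by
    rw [injective_iff_map_eq_one]
    rintro ⟨x, y⟩ hxy
    rw [hμ] at hxy
    have hx : (x : G) = (y : G)⁻¹ := mul_eq_one_iff_eq_inv.1 hxy
    have hx1 : (x : G) = 1 :=
      Subgroup.disjoint_def.1 h.disjoint x.2 (hx ▸ K.inv_mem y.2)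
    have hy1 : (y : G) = 1 := by simpa [hx1] using hxy
    exact Prod.ext (Subtype.ext hx1) (Subtype.ext hy1)
  have hsurj : Function.Surjective μ := by
    intro x
    have hx : x ∈ H ⊔ K := h.sup_eq_top ▸ Subgroup.mem_top x
    obtain ⟨y, hy, z, hz, rfl⟩ := Subgroup.mem_sup_of_normal_left.1 hx
    exact ⟨(⟨y, hy⟩, ⟨z, hz⟩), rfl⟩
  let e : H × K ≃* G := MulEquiv.ofBijective μ ⟨hinj, hsurj⟩
  have heH : ∀ x : H, e.symm x = (x, 1) := fun x => by
    rw [MulEquiv.symm_apply_eq]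
    exact (by simp [hμ] : (x : G) = μ (x, 1))
  have heK : ∀ y : K, e.symm y = (1, y) := fun y => by
    rw [MulEquiv.symm_apply_eq]
    exact (by simp [hμ] : (y : G) = μ (1, y))
  refine ⟨H.subtype.comp ((MonoidHom.fst H K).comp e.symm.toMonoidHom),
    K.subtype.comp ((MonoidHom.snd H K).comp e.symm.toMonoidHom), fun x => (e.symm x).1.2,
    fun x => (e.symm x).2.2, fun x => e.apply_symm_apply x, fun x hx => ?_, fun x hx => ?_,
    fun x => ?_⟩
  · exact congrArg (fun y : H × K => (y.1 : G)) (heH ⟨x, hx⟩)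
  · exact congrArg (fun y : H × K => (y.2 : G)) (heK ⟨x, hx⟩)
  · exact congrArg (fun y : H × K => (y.1 : G)) (heK (e.symm x).2)

/-- A normal subgroup of a metabelian group that meets the center trivially is trivial. -/
theorem IsBirkhoffMetabelian.eq_bot_of_disjoint_center {G : Type} [Group G]
    (hG : IsBirkhoffMetabelian G) {H : Subgroup G} (hH : H.Normal)
    (h : ∀ x ∈ H, x ∈ Subgroup.center G → x = 1) : H = ⊥ := by
  rw [Subgroup.eq_bot_iff_forall]
  intro x hx
  refine h x hx (Subgroup.mem_center_iff.2 fun y => ?_)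
  have h1 : ⁅y, x⁆ ∈ commutator G := by
    rw [commutator_def]
    exact Subgroup.commutator_mem_commutator (Subgroup.mem_top _) (Subgroup.mem_top _)
  have h2 : ⁅y, x⁆ ∈ H := H.mul_mem (hH.conj_mem x hx y) (H.inv_mem hx)
  exact commutatorElement_eq_one_iff_mul_comm.1 (h _ h2 (hG h1))

/-- `(A ⊆ B)` has no nontrivial direct decomposition, expressed by complementary idempotents `f`,
`g` of `B` that preserve `A`. -/
def IsIndecomposableEmbedding {B : Type} [AddCommGroup B] (A : AddSubgroup B) : Prop :=
  ∀ f g : B →+ B, f.comp f = f → g.comp g = g → f.comp g = 0 →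
    (∀ a ∈ A, f a ∈ A) → (∀ a ∈ A, g a ∈ A) → f = 0 ∨ g = 0

/-- A direct decomposition of `G(A ⊆ B)` induces one of its center `B` together with its commutator
subgroup `A`. -/
theorem EmbGroup.isIndecomposable {A : AddSubgroup B} [Nontrivial B]
    (hA : IsIndecomposableEmbedding A) : IsIndecomposableGroup (EmbGroup A) := by
  have hnt : Nontrivial (EmbGroup A) := (incl_injective (A := A)).nontrivial
  refine ⟨hnt, fun H K hH hK hHK => ?_⟩
  obtain ⟨φ, ψ, hφH, hψK, hmul, hφ, hψ, hφψ⟩ := exists_projections_of_isCompl hH hK hHK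
  have hc := Subgroup.commute_of_normal_of_disjoint H K hH hK hHK.disjoint
  have hφZ : ∀ x ∈ Subgroup.center (EmbGroup A), φ x ∈ Subgroup.center (EmbGroup A) := by
    intro x hx
    rw [Subgroup.mem_center_iff] at hx ⊢
    intro y
    have h1 : φ y * φ x = φ x * φ y := by rw [← map_mul, hx, map_mul]
    have h2 : ψ y * φ x = φ x * ψ y := (hc _ _ (hφH x) (hψK y)).eq.symm
    rw [← hmul y, mul_assoc, h2, ← mul_assoc, h1, mul_assoc]
  have hψZ : ∀ x ∈ Subgroup.center (EmbGroup A), ψ x ∈ Subgroup.center (EmbGroup A) := by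
    intro x hx
    have h1 : ψ x = (φ x)⁻¹ * x := by rw [eq_inv_mul_iff_mul_eq, hmul]
    rw [h1]
    exact Subgroup.mul_mem _ (Subgroup.inv_mem _ (hφZ x hx)) hx
  obtain ⟨f, hf, hfA⟩ := exists_hom_of_map_center φ hφZ
  obtain ⟨g, hg, hgA⟩ := exists_hom_of_map_center ψ hψZ
  have hι : ∀ b c : B, incl A (Multiplicative.ofAdd b) = incl A (Multiplicative.ofAdd c) → b = c :=
    fun b c h => Multiplicative.ofAdd.injective (incl_injective h)
  have hff : f.comp f = f := by
    ext b
    apply hι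
    rw [AddMonoidHom.comp_apply, hf, hf, hφ _ (hφH _)]
  have hgg : g.comp g = g := by
    ext b
    apply hι
    rw [AddMonoidHom.comp_apply, hg, hg, hψ _ (hψK _)]
  have hfg : f.comp g = 0 := by
    ext b
    apply hι
    rw [AddMonoidHom.comp_apply, hf, hg, hφψ, AddMonoidHom.zero_apply, ofAdd_zero, map_one]
  refine (hA f g hff hgg hfg hfA hgA).imp (fun h => ?_) (fun h => ?_)
  · refine (isBirkhoffMetabelian A).eq_bot_of_disjoint_center hH fun x hx hxZ => ?_
    obtain ⟨b, rfl⟩ := mem_center_iff.1 hxZ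
    rw [← hφ _ hx, ← hf, h, AddMonoidHom.zero_apply, ofAdd_zero, map_one]
  · refine (isBirkhoffMetabelian A).eq_bot_of_disjoint_center hK fun x hx hxZ => ?_
    obtain ⟨b, rfl⟩ := mem_center_iff.1 hxZ
    rw [← hψ _ hx, ← hg, h, AddMonoidHom.zero_apply, ofAdd_zero, map_one]

end EmbGroup

/-! ### Endomorphisms of a direct sum of cyclic `p`-groups -/

namespace CyclicSum

variable {p k : ℕ} {e : Fin k → ℕ}

theorem exists_eq_mk (hp : p.Prime) (v : CyclicSum p e) : ∃ c, v = mk p e c := by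
  refine ⟨fun i => (v i).val, funext fun i => ?_⟩
  have : NeZero (p ^ e i) := ⟨pow_ne_zero _ hp.ne_zero⟩
  exact (ZMod.natCast_zmod_val (v i)).symm

theorem mk_eq_sum (c : Fin k → ℕ) :
    mk p e c = ∑ j, c j • (Pi.single j 1 : CyclicSum p e) := by
  ext i
  rw [Finset.sum_apply, Finset.sum_eq_single i]
  · simp [mk]
  · intro j _ hj
    simp [Pi.single_eq_of_ne' hj]
  · simp

/-- The coefficient of the `i`-th generator in the image of the `j`-th one, divided by the power of
`p` that must divide it because the `j`-th generator has order `p ^ e j`. Only its residue modulo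
`p` matters below. -/
def homCoeff (f : CyclicSum p e →+ CyclicSum p e) (i j : Fin k) : ℕ :=
  (f (Pi.single j 1) i).val / p ^ (e i - e j)

theorem apply_single (hp : p.Prime) (f : CyclicSum p e →+ CyclicSum p e) (i j : Fin k) :
    f (Pi.single j 1) i = ((p ^ (e i - e j) * homCoeff f i j : ℕ) : ZMod (p ^ e i)) := by
  have : NeZero (p ^ e i) := ⟨pow_ne_zero _ hp.ne_zero⟩
  have h1 : p ^ e j • (Pi.single j 1 : CyclicSum p e) = 0 := by
    rw [← Pi.single_smul, nsmul_eq_mul, mul_one, ZMod.natCast_self, Pi.single_zero]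
  have h2 : p ^ e j • f (Pi.single j 1) i = 0 := by
    rw [← Pi.smul_apply, ← map_nsmul, h1, map_zero, Pi.zero_apply]
  have h3 : p ^ (e i - e j) ∣ (f (Pi.single j 1) i).val := by
    rcases le_total (e i) (e j) with h | h
    · simp [Nat.sub_eq_zero_of_le h]
    · rw [← ZMod.natCast_zmod_val (f (Pi.single j 1) i), nsmul_eq_mul, ← Nat.cast_mul,
        ZMod.natCast_eq_zero_iff] at h2
      refine Nat.dvd_of_mul_dvd_mul_left (pow_pos hp.pos (e j)) ?_
      rwa [← pow_add, Nat.add_sub_cancel' h]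
  rw [homCoeff, Nat.mul_div_cancel' h3, ZMod.natCast_zmod_val]

theorem apply_mk (hp : p.Prime) (f : CyclicSum p e →+ CyclicSum p e) (c : Fin k → ℕ) (i : Fin k) :
    f (mk p e c) i =
      ((∑ j, c j * (p ^ (e i - e j) * homCoeff f i j) : ℕ) : ZMod (p ^ e i)) := by
  rw [mk_eq_sum, map_sum, Finset.sum_apply, Nat.cast_sum]
  refine Finset.sum_congr rfl fun j _ => ?_
  rw [map_nsmul, Pi.smul_apply, apply_single hp, nsmul_eq_mul, ← Nat.cast_mul]

theorem cast_pow_sub {a r : ℕ} (h : r ≤ a) :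
    ((p ^ (a - r) : ℕ) : ZMod p) = if a = r then 1 else 0 := by
  split_ifs with h1
  · simp [h1]
  · rw [Nat.cast_pow, ZMod.natCast_self, zero_pow (by omega)]

/-- Comparison of the terms of lowest order: if `f` maps a vector with coordinates `γ j * p ^ a j`
to an integral combination of vectors with coordinates `δ s i * p ^ b s i`, then the equation
between the `i`-th coordinates can be divided by `p ^ r` and read modulo `p`, provided that `p ^ r`
divides all its terms. -/
theorem leading_coeff (hp : p.Prime) {f : CyclicSum p e →+ CyclicSum p e} {n : ℕ}
    {a γ : Fin k → ℕ} {b δ : Fin n → Fin k → ℕ} {m : Fin n → ℤ}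
    (h : f (mk p e fun j => γ j * p ^ a j) = ∑ s, m s • mk p e fun j => δ s j * p ^ b s j)
    (i : Fin k) (r : ℕ) (hr : r < e i) (ha : ∀ j, r ≤ a j + (e i - e j)) (hb : ∀ s, r ≤ b s i) :
    ∑ j, (γ j : ZMod p) * (if a j + (e i - e j) = r then (homCoeff f i j : ZMod p) else 0) =
      ∑ s, (m s : ZMod p) * (if b s i = r then (δ s i : ZMod p) else 0) := by
  set X : ℤ := ∑ j, (γ j : ℤ) * ((p ^ (a j + (e i - e j) - r) : ℕ) * (homCoeff f i j : ℤ)) with hX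
  set Y : ℤ := ∑ s, m s * ((p ^ (b s i - r) : ℕ) * (δ s i : ℤ)) with hY
  have h1 : ((p ^ r * X : ℤ) : ZMod (p ^ e i)) = ((p ^ r * Y : ℤ) : ZMod (p ^ e i)) := by
    have h2 := congrFun h i
    rw [apply_mk hp, Finset.sum_apply, ← Int.cast_natCast] at h2
    have h3 : ((∑ j, γ j * p ^ a j * (p ^ (e i - e j) * homCoeff f i j) : ℕ) : ℤ) = p ^ r * X := by
      rw [hX, Finset.mul_sum, Nat.cast_sum]
      refine Finset.sum_congr rfl fun j _ => ?_
      have h4 : (p : ℤ) ^ a j * p ^ (e i - e j) = p ^ r * p ^ (a j + (e i - e j) - r) := by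
        rw [← pow_add, ← pow_add, Nat.add_sub_cancel' (ha j)]
      push_cast
      linear_combination (γ j : ℤ) * homCoeff f i j * h4
    rw [h3] at h2
    rw [h2, hY, Finset.mul_sum, Int.cast_sum]
    refine Finset.sum_congr rfl fun s _ => ?_
    have h4 : (p : ℤ) ^ b s i = p ^ r * p ^ (b s i - r) := by
      rw [← pow_add, Nat.add_sub_cancel' (hb s)]
    have h5 : (m s • mk p e fun j => δ s j * p ^ b s j) i =
        ((m s * (δ s i * (p : ℤ) ^ b s i) : ℤ) : ZMod (p ^ e i)) := by
      simp [mk]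
    rw [h5, h4]
    congr 1
    push_cast
    ring
  rw [ZMod.intCast_eq_intCast_iff_dvd_sub, ← mul_sub] at h1
  have h2 : (p : ℤ) ∣ Y - X := by
    have h3 : (p : ℤ) ^ r * p ∣ p ^ r * (Y - X) := by
      refine dvd_trans ?_ h1
      rw [← pow_succ, Nat.cast_pow]
      exact pow_dvd_pow _ hr
    exact Int.dvd_of_mul_dvd_mul_left (pow_ne_zero _ (by exact_mod_cast hp.ne_zero)) h3
  have h3 := (ZMod.intCast_eq_intCast_iff_dvd_sub X Y p).2 h2
  rw [hX, hY, Int.cast_sum, Int.cast_sum] at h3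
  refine (Eq.trans ?_ h3).trans ?_
  · refine Finset.sum_congr rfl fun j _ => ?_
    rw [Int.cast_mul, Int.cast_mul, Int.cast_natCast, Int.cast_natCast, Int.cast_natCast,
      cast_pow_sub (ha j), ite_mul, one_mul, zero_mul]
  · refine Finset.sum_congr rfl fun s _ => ?_
    rw [Int.cast_mul, Int.cast_mul, Int.cast_natCast, Int.cast_natCast,
      cast_pow_sub (hb s), ite_mul, one_mul, zero_mul]

/-- Modulo `p`, the block of coefficients between the generators of a given order is
multiplicative: the other summands of the matrix product carry a factor `p`. -/
theorem homCoeff_comp (hp : p.Prime) (f g : CyclicSum p e →+ CyclicSum p e) {i j : Fin k}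
    (hij : e i = e j) (hi : 0 < e i) :
    (homCoeff (f.comp g) i j : ZMod p) =
      ∑ l, if e l = e i then (homCoeff f i l : ZMod p) * homCoeff g l j else 0 := by
  have h1 : (Pi.single j 1 : CyclicSum p e) = mk p e (Pi.single j 1) := by
    rw [mk_eq_sum, Finset.sum_eq_single j] <;> simp +contextual
  have h2 : g (Pi.single j 1) = mk p e fun l => p ^ (e l - e j) * homCoeff g l j := by
    ext l
    rw [apply_single hp, mk]
  have h3 : ((homCoeff (f.comp g) i j : ℕ) : ZMod (p ^ e i)) = ((∑ l, p ^ (e l - e j) *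
      homCoeff g l j * (p ^ (e i - e l) * homCoeff f i l) : ℕ) : ZMod (p ^ e i)) := by
    rw [← apply_mk hp, ← h2, ← AddMonoidHom.comp_apply, apply_single hp, hij, Nat.sub_self,
      pow_zero, one_mul]
  have h4 := congrArg (ZMod.castHom (dvd_pow_self p hi.ne') (ZMod p)) h3
  rw [map_natCast, map_natCast, Nat.cast_sum] at h4
  rw [h4]
  refine Finset.sum_congr rfl fun l _ => ?_
  have h5 := cast_pow_sub (p := p) (Nat.zero_le ((e l - e j) + (e i - e l)))
  have h6 : ((e l - e j) + (e i - e l) = 0) ↔ e l = e i := by omega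
  rw [Nat.sub_zero, pow_add, Nat.cast_mul] at h5
  simp only [h6] at h5
  have h7 : (if e l = e i then (homCoeff f i l : ZMod p) * homCoeff g l j else 0) =
      (if e l = e i then 1 else 0) * ((homCoeff f i l : ZMod p) * homCoeff g l j) := by
    rw [ite_mul, one_mul, zero_mul]
  rw [h7, ← h5]
  push_cast
  ring

theorem homCoeff_zero (i j : Fin k) : homCoeff (0 : CyclicSum p e →+ CyclicSum p e) i j = 0 := by
  simp [homCoeff]

theorem homCoeff_id (hp : p.Prime) {i j : Fin k} (hij : e i = e j) (hi : 0 < e i) :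
    homCoeff (AddMonoidHom.id (CyclicSum p e)) i j = if i = j then 1 else 0 := by
  rw [homCoeff, Nat.sub_eq_zero_of_le hij.le, pow_zero, Nat.div_one, AddMonoidHom.id_apply]
  split_ifs with h
  · subst h
    have : Fact (1 < p ^ e i) := ⟨Nat.one_lt_pow hi.ne' hp.one_lt⟩
    rw [Pi.single_eq_same, ZMod.val_one]
  · rw [Pi.single_eq_of_ne h, ZMod.val_zero]

/-- An idempotent endomorphism whose blocks between generators of equal order vanish modulo `p` is
zero, because it is nilpotent modulo `p`. -/
theorem eq_zero_of_comp_self (hp : p.Prime) (he : ∀ i, 0 < e i)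
    {f : CyclicSum p e →+ CyclicSum p e} (hf : f.comp f = f)
    (h : ∀ i j, e i = e j → (homCoeff f i j : ZMod p) = 0) : f = 0 := by
  have hff : ∀ v, f (f v) = f v := fun v => DFunLike.congr_fun hf v
  have hdvd : ∀ c : Fin k → ℕ, f (mk p e c) = mk p e c → ∀ i, p ∣ c i := by
    intro c hc
    by_contra! hne
    obtain ⟨i0, hi0⟩ := hne
    -- Among the coordinates not divisible by `p`, one belonging to a generator of largest order.
    obtain ⟨i, hi, hmax⟩ := Finset.exists_max_image
      (Finset.univ.filter fun i => ¬ p ∣ c i) e ⟨i0, by simpa using hi0⟩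
    rw [Finset.mem_filter_univ] at hi
    have h1 := congrFun hc i
    rw [apply_mk hp] at h1
    have h2 := congrArg (ZMod.castHom (dvd_pow_self p (he i).ne') (ZMod p)) h1
    rw [mk, map_natCast, map_natCast, Nat.cast_sum, Finset.sum_eq_zero] at h2
    · exact hi ((ZMod.natCast_eq_zero_iff _ _).1 h2.symm)
    · intro j _
      rcases lt_trichotomy (e i) (e j) with hlt | heq | hgt
      · have hj : p ∣ c j := by
          by_contra hj
          exact absurd (hmax j (by simpa using hj)) (by omega)
        rw [Nat.cast_mul, (ZMod.natCast_eq_zero_iff _ _).2 hj, zero_mul]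
      · rw [Nat.cast_mul, Nat.cast_mul, h i j heq, mul_zero, mul_zero]
      · rw [Nat.cast_mul, Nat.cast_mul, Nat.cast_pow, ZMod.natCast_self,
          zero_pow (by omega), zero_mul, mul_zero]
  have hstep : ∀ v, ∃ w, f v = p • f w := by
    intro v
    obtain ⟨c, hc⟩ := exists_eq_mk hp (f v)
    have h1 := hdvd c (by rw [← hc, hff])
    refine ⟨mk p e fun i => c i / p, ?_⟩
    have h2 : f v = p • mk p e fun i => c i / p := by
      rw [hc]
      ext i
      rw [Pi.smul_apply, mk, mk, nsmul_eq_mul, ← Nat.cast_mul, Nat.mul_div_cancel' (h1 i)]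
    rw [← map_nsmul, ← h2, hff]
  have hpow : ∀ n v, ∃ w, f v = p ^ n • f w := by
    intro n
    induction n with
    | zero => exact fun v => ⟨v, by simp⟩
    | succ n ih =>
      intro v
      obtain ⟨w, hw⟩ := ih v
      obtain ⟨u, hu⟩ := hstep w
      exact ⟨u, by rw [hw, hu, smul_smul, pow_succ]⟩
  refine AddMonoidHom.ext fun v => funext fun i => ?_
  obtain ⟨w, hw⟩ := hpow (e i) v
  rw [hw, Pi.smul_apply, nsmul_eq_mul, ZMod.natCast_self, zero_mul, AddMonoidHom.zero_apply,
    Pi.zero_apply]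

/-! ### Order and exponent of direct sums and of their subgroups -/

theorem finite (hp : p.Prime) : Finite (CyclicSum p e) := by
  have : ∀ i, NeZero (p ^ e i) := fun i => ⟨pow_ne_zero _ hp.ne_zero⟩
  infer_instance

theorem natCard_eq : Nat.card (CyclicSum p e) = p ^ ∑ i, e i := by
  rw [Nat.card_pi, Finset.prod_congr rfl fun i _ => Nat.card_zmod (p ^ e i),
    Finset.prod_pow_eq_pow_sum]

theorem pow_smul_eq_zero {n : ℕ} (hn : ∀ i, e i ≤ n) (v : CyclicSum p e) : p ^ n • v = 0 := by
  ext i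
  rw [Pi.smul_apply, nsmul_eq_mul, (ZMod.natCast_eq_zero_iff _ _).2 (pow_dvd_pow p (hn i)),
    zero_mul, Pi.zero_apply]

theorem exponent_eq {n : ℕ} (hn : ∀ i, e i ≤ n) {i : Fin k} (hi : e i = n) :
    AddMonoid.exponent (CyclicSum p e) = p ^ n := by
  apply Nat.dvd_antisymm
  · exact AddMonoid.exponent_dvd_iff_forall_nsmul_eq_zero.2 (pow_smul_eq_zero hn)
  · have h := congrFun (AddMonoid.exponent_nsmul_eq_zero (Pi.single i 1 : CyclicSum p e)) i
    rw [Pi.smul_apply, Pi.single_eq_same, nsmul_eq_mul, mul_one, Pi.zero_apply,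
      ZMod.natCast_eq_zero_iff, hi] at h
    exact h

end CyclicSum

theorem AddSubgroup.mem_closure_range_iff_exists_sum {B : Type*} [AddCommGroup B] {n : ℕ}
    {g : Fin n → B} {x : B} :
    x ∈ AddSubgroup.closure (Set.range g) ↔ ∃ m : Fin n → ℤ, ∑ s, m s • g s = x := by
  rw [← Submodule.mem_span_range_iff_exists_fun, ← AddSubgroup.toIntSubmodule_closure]
  rfl

section Relations

variable {B : Type*} [AddCommGroup B] {p n : ℕ} {g : Fin n → B} {d : Fin n → ℕ}

/-- If the only relations between the generators are `p ^ d s • g s = 0`, then they span a direct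
sum of cyclic groups of orders `p ^ d s`. -/
theorem natCard_closure_of_relations
    (h : ∀ m : Fin n → ℤ, ∑ s, m s • g s = 0 ↔ ∀ s, ((p ^ d s : ℕ) : ℤ) ∣ m s) :
    Nat.card (AddSubgroup.closure (Set.range g)) = p ^ ∑ s, d s := by
  let φ : (Fin n → ℤ) →+ B := AddMonoidHom.mk' (fun m => ∑ s, m s • g s) fun a b => by
    simp [add_smul, Finset.sum_add_distrib]
  let ψ : (Fin n → ℤ) →+ CyclicSum p d := AddMonoidHom.mk' (fun m s => (m s : ZMod (p ^ d s)))
    fun a b => by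
      ext s
      simp
  have hφ : φ.range = AddSubgroup.closure (Set.range g) := by
    ext x
    rw [AddSubgroup.mem_closure_range_iff_exists_sum]
    rfl
  have hψ : Function.Surjective ψ := fun v => by
    choose m hm using fun s => ZMod.intCast_surjective (v s)
    exact ⟨m, funext hm⟩
  have hker : φ.ker = ψ.ker := by
    ext m
    rw [AddMonoidHom.mem_ker, AddMonoidHom.mem_ker]
    refine (h m).trans ?_
    rw [funext_iff]
    exact forall_congr' fun s => (ZMod.intCast_zmod_eq_zero_iff_dvd _ _).symm
  rw [← hφ, ← CyclicSum.natCard_eq,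
    ← Nat.card_congr (QuotientAddGroup.quotientKerEquivRange φ).toEquiv, hker,
    Nat.card_congr (QuotientAddGroup.quotientKerEquivOfSurjective ψ hψ).toEquiv]

theorem exponent_closure_of_relations
    (h : ∀ m : Fin n → ℤ, ∑ s, m s • g s = 0 ↔ ∀ s, ((p ^ d s : ℕ) : ℤ) ∣ m s) {N : ℕ}
    (hN : ∀ s, d s ≤ N) {s₀ : Fin n} (hs₀ : d s₀ = N) :
    AddMonoid.exponent (AddSubgroup.closure (Set.range g)) = p ^ N := by
  apply Nat.dvd_antisymm
  · rw [AddMonoid.exponent_dvd_iff_forall_nsmul_eq_zero]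
    rintro ⟨x, hx⟩
    obtain ⟨m, rfl⟩ := AddSubgroup.mem_closure_range_iff_exists_sum.1 hx
    ext
    have h1 : ∑ s, ((p ^ N : ℕ) * m s : ℤ) • g s = 0 := (h _).2 fun s =>
      Dvd.dvd.mul_right (Int.natCast_dvd_natCast.2 (pow_dvd_pow p (hN s))) _
    simpa [Finset.smul_sum, mul_smul, ← natCast_zsmul] using h1
  · have h1 := AddMonoid.exponent_nsmul_eq_zero (⟨g s₀, AddSubgroup.subset_closure ⟨s₀, rfl⟩⟩ :
      AddSubgroup.closure (Set.range g))
    have h2 := congrArg Subtype.val h1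
    have h3 := (h (Pi.single s₀ (AddMonoid.exponent (AddSubgroup.closure (Set.range g)) : ℤ))).1 (by
      rw [Finset.sum_eq_single s₀]
      · simpa using h2
      · intro s _ hs
        rw [Pi.single_eq_of_ne hs, zero_smul]
      · simp) s₀
    rw [Pi.single_eq_same, hs₀] at h3
    exact Int.natCast_dvd_natCast.1 h3

end Relations

open CyclicSum (homCoeff homCoeff_comp homCoeff_id homCoeff_zero leading_coeff)

theorem Fin.forall_fin_five {P : Fin 5 → Prop} :
    (∀ i, P i) ↔ P 0 ∧ P 1 ∧ P 2 ∧ P 3 ∧ P 4 := by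
  refine ⟨fun h => ⟨h 0, h 1, h 2, h 3, h 4⟩, fun ⟨h0, h1, h2, h3, h4⟩ i => ?_⟩
  fin_cases i <;> assumption

theorem Fin.forall_fin_ten {P : Fin 10 → Prop} :
    (∀ i, P i) ↔ P 0 ∧ P 1 ∧ P 2 ∧ P 3 ∧ P 4 ∧ P 5 ∧ P 6 ∧ P 7 ∧ P 8 ∧ P 9 := by
  refine ⟨fun h => ⟨h 0, h 1, h 2, h 3, h 4, h 5, h 6, h 7, h 8, h 9⟩,
    fun ⟨h0, h1, h2, h3, h4, h5, h6, h7, h8, h9⟩ i => ?_⟩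
  fin_cases i <;> assumption

theorem Fin.sum_univ_ten {M : Type*} [AddCommMonoid M] (x : Fin 10 → M) :
    ∑ i, x i = x 0 + x 1 + x 2 + x 3 + x 4 + x 5 + x 6 + x 7 + x 8 + x 9 := by
  rw [Fin.sum_univ_castSucc, Fin.sum_univ_castSucc, Fin.sum_univ_eight]
  rfl

/-- In a direct sum of cyclic groups of orders `p ^ d s`, an element killed by `p` has coefficients
divisible by `p ^ (d s - 1)`. -/
theorem exists_eq_sum_of_smul_eq_zero {B : Type*} [AddCommGroup B] {p n : ℕ} (hp : p.Prime)
    {g : Fin n → B} {d : Fin n → ℕ} (hd : ∀ s, 0 < d s)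
    (h : ∀ m : Fin n → ℤ, ∑ s, m s • g s = 0 ↔ ∀ s, ((p ^ d s : ℕ) : ℤ) ∣ m s)
    {m : Fin n → ℤ} (hm : p • ∑ s, m s • g s = 0) :
    ∃ m' : Fin n → ℤ, ∑ s, m s • g s = ∑ s, m' s • p ^ (d s - 1) • g s := by
  have h1 : ∀ s, ((p ^ d s : ℕ) : ℤ) ∣ p * m s := (h _).1 (by
    simpa [Finset.smul_sum, mul_smul, ← natCast_zsmul] using hm)
  have h2 : ∀ s, ((p ^ (d s - 1) : ℕ) : ℤ) ∣ m s := fun s => by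
    have h3 := h1 s
    rw [← Nat.sub_add_cancel (hd s), pow_succ', Nat.cast_mul] at h3
    exact Int.dvd_of_mul_dvd_mul_left (by exact_mod_cast hp.ne_zero) h3
  choose m' hm' using h2
  refine ⟨m', Finset.sum_congr rfl fun s _ => ?_⟩
  rw [← natCast_zsmul (g s), smul_smul, hm', mul_comm]

theorem CyclicSum.pow_smul_mk {p k : ℕ} {e : Fin k → ℕ} (γ a : Fin k → ℕ) (r : ℕ) :
    p ^ r • mk p e (fun i => γ i * p ^ a i) = mk p e fun i => γ i * p ^ (a i + r) := by
  ext i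
  rw [Pi.smul_apply, mk, mk, nsmul_eq_mul, ← Nat.cast_mul]
  congr 1
  ring

theorem Int.pow_dvd_of_pow_add_dvd_mul_pow {p : ℤ} (hp : p ≠ 0) {m : ℤ} (a b : ℕ)
    (h : p ^ (a + b) ∣ m * p ^ b) : p ^ a ∣ m := by
  rw [pow_add] at h
  exact Int.dvd_of_mul_dvd_mul_right (pow_ne_zero b hp) h

/-! ### The embeddings `A_l ⊆ B` -/

section FamilyA

/-- The generators of `A_l` have the coordinates `cofA l s i * p ^ powA s i`. Where the coordinate
vanishes, the exponent is arbitrary, but so large that it never constrains the lowest order. -/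
def powA : Fin 3 → Fin 5 → ℕ := ![![4, 8, 8, 1, 0], ![8, 3, 2, 8, 0], ![8, 8, 3, 2, 8]]

/-- The factors prime to the powers of `p` in the coordinates of the generators of `A_l`,
see `powA`. -/
def cofA (l : ℕ) : Fin 3 → Fin 5 → ℕ := ![![1, 0, 0, 1, 1], ![0, 1, 1, 0, 1], ![0, 0, 1, l, 0]]

/-- The generators of `A_l`. -/
def genA (p l : ℕ) (s : Fin 3) : CyclicSum p expB :=
  CyclicSum.mk p expB fun i => cofA l s i * p ^ powA s i

/-- The exponents of the orders of the generators of `A_l`. -/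
def ordA : Fin 3 → ℕ := ![3, 3, 1]

theorem subA_eq_closure_range (p l : ℕ) :
    subA p l = AddSubgroup.closure (Set.range (genA p l)) := by
  have h : genA p l = ![CyclicSum.mk p expB ![p ^ 4, 0, 0, p, 1],
      CyclicSum.mk p expB ![0, p ^ 3, p ^ 2, 0, 1],
      CyclicSum.mk p expB ![0, 0, p ^ 3, l * p ^ 2, 0]] := by
    funext s
    fin_cases s <;> simp only [genA] <;> apply congrArg <;> funext i <;> fin_cases i <;>
      simp [cofA, powA]
  rw [h, subA]
  simp only [Matrix.range_cons, Matrix.range_empty, Set.union_empty, Set.singleton_union]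

theorem relations_genA {p : ℕ} (hp : p.Prime) (l : ℕ) (m : Fin 3 → ℤ) :
    ∑ s, m s • genA p l s = 0 ↔ ∀ s, ((p ^ ordA s : ℕ) : ℤ) ∣ m s := by
  have hp0 : (p : ℤ) ≠ 0 := by exact_mod_cast hp.ne_zero
  have hco : ∀ i, (∑ s, m s • genA p l s) i =
      ((∑ s, m s * (cofA l s i * p ^ powA s i : ℕ) : ℤ) : ZMod (p ^ expB i)) := fun i => by
    simp [genA, CyclicSum.mk, Finset.sum_apply]
  rw [funext_iff]
  simp only [hco, Pi.zero_apply, ZMod.intCast_zmod_eq_zero_iff_dvd]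
  suffices (p : ℤ) ^ 7 ∣ m 0 * p ^ 4 ∧ (p : ℤ) ^ 6 ∣ m 1 * p ^ 3 ∧
      (p : ℤ) ^ 4 ∣ m 1 * p ^ 2 + m 2 * p ^ 3 ∧ (p : ℤ) ^ 3 ∣ m 0 * p + m 2 * (l * p ^ 2) ∧
      (p : ℤ) ∣ m 0 + m 1 ↔ (p : ℤ) ^ 3 ∣ m 0 ∧ (p : ℤ) ^ 3 ∣ m 1 ∧ (p : ℤ) ∣ m 2 by
    simpa [Fin.forall_fin_succ, Fin.sum_univ_succ, cofA, powA, expB, ordA] using this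
  constructor
  · rintro ⟨h0, h1, h2, -, -⟩
    have h0' := Int.pow_dvd_of_pow_add_dvd_mul_pow hp0 3 4 h0
    have h1' := Int.pow_dvd_of_pow_add_dvd_mul_pow hp0 3 3 h1
    refine ⟨h0', h1', ?_⟩
    obtain ⟨b, hb⟩ := h1'
    rw [hb] at h2
    have h2' := (dvd_add_right (⟨p * b, by ring⟩ : (p : ℤ) ^ 4 ∣ p ^ 3 * b * p ^ 2)).1 h2
    simpa using Int.pow_dvd_of_pow_add_dvd_mul_pow hp0 1 3 h2'
  · rintro ⟨⟨a, ha⟩, ⟨b, hb⟩, ⟨c, hc⟩⟩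
    rw [ha, hb, hc]
    exact ⟨⟨a, by ring⟩, ⟨b, by ring⟩, ⟨p * b + c, by ring⟩, ⟨p * a + c * l, by ring⟩,
      ⟨p ^ 2 * a + p ^ 2 * b, by ring⟩⟩

/-- The power of `p` that divides the `i`-th coordinates of all elements of `A_l`. -/
def lowA : Fin 5 → ℕ := ![4, 3, 2, 1, 0]

/-- A power of `p` that divides the `i`-th coordinates of all elements `x` of `A_l` with `p x = 0`;
the last coordinate vanishes there and gets the trivial bound. -/
def lowA' : Fin 5 → ℕ := ![6, 5, 3, 2, 0]

/-- The leading coefficients of a morphism from `A_l ⊆ B` to `A_l' ⊆ B`: all diagonal coefficients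
agree modulo `p`, and their common value intertwines `l` and `l'`. -/
theorem homCoeff_of_map_subA {p : ℕ} (hp : p.Prime) {l l' : ℕ}
    {f : CyclicSum p expB →+ CyclicSum p expB} (hf : ∀ a ∈ subA p l, f a ∈ subA p l') :
    (∀ i, (homCoeff f i i : ZMod p) = homCoeff f 4 4) ∧
      (l : ZMod p) * homCoeff f 4 4 = l' * homCoeff f 4 4 := by
  have hmem : ∀ s, ∃ m : Fin 3 → ℤ, f (genA p l s) = ∑ t, m t • genA p l' t := fun s => by
    rw [subA_eq_closure_range, subA_eq_closure_range] at hf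
    obtain ⟨m, hm⟩ := AddSubgroup.mem_closure_range_iff_exists_sum.1
      (hf _ (AddSubgroup.subset_closure ⟨s, rfl⟩))
    exact ⟨m, hm.symm⟩
  obtain ⟨m0, h0⟩ := hmem 0
  obtain ⟨m1, h1⟩ := hmem 1
  obtain ⟨m2, h2⟩ := hmem 2
  -- The third generator has order `p`, which restricts the coefficients of its image.
  have hp2 : p • genA p l 2 = 0 := by
    have h3 := (relations_genA hp l (Pi.single 2 p)).2
      (by simp [Fin.forall_fin_succ, ordA, Pi.single_apply])
    simpa [Fin.sum_univ_succ] using h3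
  obtain ⟨n, hn⟩ := exists_eq_sum_of_smul_eq_zero hp (by decide) (relations_genA hp l')
    (by rw [← h2, ← map_nsmul, hp2, map_zero] : p • ∑ t, m2 t • genA p l' t = 0)
  rw [hn] at h2
  simp only [genA, CyclicSum.pow_smul_mk] at h0 h1 h2
  have hlow : ∀ i, lowA i < expB i := by decide
  have hlow' : ∀ i, lowA' i < expB i := by decide
  have e0 := fun i => leading_coeff hp h0 i (lowA i) (hlow i)
    ((by decide : ∀ i j, lowA i ≤ powA 0 j + (expB i - expB j)) i)
    ((by decide : ∀ i s, lowA i ≤ powA s i) i)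
  have e1 := fun i => leading_coeff hp h1 i (lowA i) (hlow i)
    ((by decide : ∀ i j, lowA i ≤ powA 1 j + (expB i - expB j)) i)
    ((by decide : ∀ i s, lowA i ≤ powA s i) i)
  have e2 := fun i => leading_coeff hp h2 i (lowA' i) (hlow' i)
    ((by decide : ∀ i j, lowA' i ≤ powA 2 j + (expB i - expB j)) i)
    ((by decide : ∀ i s, lowA' i ≤ powA s i + (ordA s - 1)) i)
  generalize homCoeff f = F at e0 e1 e2 ⊢
  simp [Fin.forall_fin_five, Fin.sum_univ_three, Fin.sum_univ_five, lowA, lowA', powA, cofA, expB, ordA] at e0 e1 e2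
  obtain ⟨a0, a1, a2, a3, a4⟩ := e0
  obtain ⟨-, b1, b2, b3, b4⟩ := e1
  obtain ⟨-, -, d2, d3⟩ := e2
  have f00 : (F 0 0 : ZMod p) = F 4 4 := by linear_combination a0 - a4 + a1
  have f11 : (F 1 1 : ZMod p) = F 4 4 := by linear_combination b1 - b4 + b3
  have f22 : (F 2 2 : ZMod p) = F 4 4 := by linear_combination b2 - b4 + b3
  have f33 : (F 3 3 : ZMod p) = F 4 4 := by linear_combination a3 - a4 + a1
  have f23 : (F 2 3 : ZMod p) = 0 := by linear_combination a2 - a1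
  rw [f22, f23] at d2
  rw [f33] at d3
  exact ⟨by simp [Fin.forall_fin_five, f00, f11, f22, f33], by linear_combination d3 - l' * d2⟩

end FamilyA

/-! ### The embeddings `C_{l,m} ⊆ D` -/

section FamilyC

/-- The generators of `C_{l,m}` have the coordinates `cofC l m s i * p ^ powC s i`, with large
exponents where the coordinate vanishes, as in `powA`. -/
def powC : Fin 6 → Fin 10 → ℕ :=
  ![![5, 4, 9, 9, 9, 9, 1, 9, 0, 9],
    ![9, 4, 9, 9, 9, 9, 9, 1, 9, 0],
    ![9, 9, 3, 9, 2, 9, 9, 9, 0, 9],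
    ![9, 9, 9, 3, 9, 2, 9, 9, 9, 0],
    ![9, 9, 9, 9, 3, 9, 2, 9, 9, 9],
    ![9, 9, 9, 9, 9, 3, 9, 2, 9, 9]]

/-- The factors prime to the powers of `p` in the coordinates of the generators of `C_{l,m}`,
see `powC`. -/
def cofC (l m : ℕ) : Fin 6 → Fin 10 → ℕ :=
  ![![1, 1, 0, 0, 0, 0, 1, 0, 1, 0],
    ![0, 1, 0, 0, 0, 0, 0, 1, 0, 1],
    ![0, 0, 1, 0, 1, 0, 0, 0, 1, 0],
    ![0, 0, 0, 1, 0, 1, 0, 0, 0, 1],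
    ![0, 0, 0, 0, 1, 0, l, 0, 0, 0],
    ![0, 0, 0, 0, 0, 1, 0, m, 0, 0]]

/-- The generators of `C_{l,m}`. -/
def genC (p l m : ℕ) (s : Fin 6) : CyclicSum p expD :=
  CyclicSum.mk p expD fun i => cofC l m s i * p ^ powC s i

/-- The exponents of the orders of the generators of `C_{l,m}`. -/
def ordC : Fin 6 → ℕ := ![3, 3, 3, 3, 1, 1]

theorem subC_eq_closure_range (p l m : ℕ) :
    subC p l m = AddSubgroup.closure (Set.range (genC p l m)) := by
  have h : genC p l m = ![CyclicSum.mk p expD ![p ^ 5, p ^ 4, 0, 0, 0, 0, p, 0, 1, 0],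
      CyclicSum.mk p expD ![0, p ^ 4, 0, 0, 0, 0, 0, p, 0, 1],
      CyclicSum.mk p expD ![0, 0, p ^ 3, 0, p ^ 2, 0, 0, 0, 1, 0],
      CyclicSum.mk p expD ![0, 0, 0, p ^ 3, 0, p ^ 2, 0, 0, 0, 1],
      CyclicSum.mk p expD ![0, 0, 0, 0, p ^ 3, 0, l * p ^ 2, 0, 0, 0],
      CyclicSum.mk p expD ![0, 0, 0, 0, 0, p ^ 3, 0, m * p ^ 2, 0, 0]] := by
    funext s
    fin_cases s <;> simp only [genC] <;> apply congrArg <;> funext i <;> fin_cases i <;>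
      simp [cofC, powC]
  rw [h, subC]
  simp only [Matrix.range_cons, Matrix.range_empty, Set.union_empty, Set.singleton_union]

theorem relations_genC {p : ℕ} (hp : p.Prime) (l m : ℕ) (c : Fin 6 → ℤ) :
    ∑ s, c s • genC p l m s = 0 ↔ ∀ s, ((p ^ ordC s : ℕ) : ℤ) ∣ c s := by
  have hp0 : (p : ℤ) ≠ 0 := by exact_mod_cast hp.ne_zero
  have hco : ∀ i, (∑ s, c s • genC p l m s) i =
      ((∑ s, c s * (cofC l m s i * p ^ powC s i : ℕ) : ℤ) : ZMod (p ^ expD i)) := fun i => by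
    simp [genC, CyclicSum.mk, Finset.sum_apply]
  rw [funext_iff]
  simp only [hco, Pi.zero_apply, ZMod.intCast_zmod_eq_zero_iff_dvd]
  suffices (p : ℤ) ^ 8 ∣ c 0 * p ^ 5 ∧ (p : ℤ) ^ 7 ∣ c 0 * p ^ 4 + c 1 * p ^ 4 ∧
      (p : ℤ) ^ 6 ∣ c 2 * p ^ 3 ∧ (p : ℤ) ^ 6 ∣ c 3 * p ^ 3 ∧
      (p : ℤ) ^ 4 ∣ c 2 * p ^ 2 + c 4 * p ^ 3 ∧ (p : ℤ) ^ 4 ∣ c 3 * p ^ 2 + c 5 * p ^ 3 ∧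
      (p : ℤ) ^ 3 ∣ c 0 * p + c 4 * (l * p ^ 2) ∧ (p : ℤ) ^ 3 ∣ c 1 * p + c 5 * (m * p ^ 2) ∧
      (p : ℤ) ∣ c 0 + c 2 ∧ (p : ℤ) ∣ c 1 + c 3 ↔
      (p : ℤ) ^ 3 ∣ c 0 ∧ (p : ℤ) ^ 3 ∣ c 1 ∧ (p : ℤ) ^ 3 ∣ c 2 ∧ (p : ℤ) ^ 3 ∣ c 3 ∧
      (p : ℤ) ∣ c 4 ∧ (p : ℤ) ∣ c 5 by
    simpa [Fin.forall_fin_succ, Fin.sum_univ_succ, cofC, powC, expD, ordC] using this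
  have cancel := fun {x : ℤ} => Int.pow_dvd_of_pow_add_dvd_mul_pow hp0 (m := x)
  have last : ∀ {x y : ℤ}, (p : ℤ) ^ 3 ∣ x → (p : ℤ) ^ 4 ∣ x * p ^ 2 + y * p ^ 3 → (p : ℤ) ∣ y := by
    rintro _ y ⟨b, rfl⟩ h
    have h' := (dvd_add_right (⟨p * b, by ring⟩ : (p : ℤ) ^ 4 ∣ p ^ 3 * b * p ^ 2)).1 h
    simpa using cancel 1 3 h'
  constructor
  · rintro ⟨h0, h1, h2, h3, h4, h5, -⟩
    rw [← add_mul] at h1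
    have h0' := cancel 3 5 h0
    exact ⟨h0', (dvd_add_right h0').1 (cancel 3 4 h1), cancel 3 3 h2, cancel 3 3 h3,
      last (cancel 3 3 h2) h4, last (cancel 3 3 h3) h5⟩
  · rintro ⟨⟨a0, h0⟩, ⟨a1, h1⟩, ⟨a2, h2⟩, ⟨a3, h3⟩, ⟨a4, h4⟩, ⟨a5, h5⟩⟩
    rw [h0, h1, h2, h3, h4, h5]
    exact ⟨⟨a0, by ring⟩, ⟨a0 + a1, by ring⟩, ⟨a2, by ring⟩, ⟨a3, by ring⟩, ⟨p * a2 + a4, by ring⟩,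
      ⟨p * a3 + a5, by ring⟩, ⟨p * a0 + a4 * l, by ring⟩, ⟨p * a1 + a5 * m, by ring⟩,
      ⟨p ^ 2 * a0 + p ^ 2 * a2, by ring⟩, ⟨p ^ 2 * a1 + p ^ 2 * a3, by ring⟩⟩

/-- The power of `p` that divides the `i`-th coordinates of all elements of `C_{l,m}`. -/
def lowC : Fin 10 → ℕ := ![5, 4, 3, 3, 2, 2, 1, 1, 0, 0]

/-- A power of `p` that divides the `i`-th coordinates of all elements `x` of `C_{l,m}` with
`p x = 0`; the last two coordinates vanish there and get the trivial bound. -/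
def lowC' : Fin 10 → ℕ := ![7, 6, 5, 5, 3, 3, 2, 2, 0, 0]

set_option maxHeartbeats 1000000 in
/-- The leading coefficients of a morphism from `C_{l,m} ⊆ D` to `C_{l',m'} ⊆ D`. The blocks at
`x₃, x₄`, at `y₁, y₂`, at `y₃, y₄` and at `z₁, z₂` are the same `2 × 2`-matrix modulo `p`, which
intertwines `diag(l, m)` and `diag(l', m')`, and has equal column sums. It determines the
coefficients at `x₁` and `x₂`, so all these blocks vanish together. -/
theorem homCoeff_of_map_subC {p : ℕ} (hp : p.Prime) {l m l' m' : ℕ}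
    {f : CyclicSum p expD →+ CyclicSum p expD} (hf : ∀ a ∈ subC p l m, f a ∈ subC p l' m') :
    ((homCoeff f 8 8 : ZMod p) = 0 → (homCoeff f 9 8 : ZMod p) = 0 →
      (homCoeff f 8 9 : ZMod p) = 0 → (homCoeff f 9 9 : ZMod p) = 0 →
      ∀ i j, expD i = expD j → (homCoeff f i j : ZMod p) = 0) ∧
    (homCoeff f 8 8 + homCoeff f 9 8 : ZMod p) = homCoeff f 8 9 + homCoeff f 9 9 ∧
    (l : ZMod p) * homCoeff f 8 8 = l' * homCoeff f 8 8 ∧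
    (l : ZMod p) * homCoeff f 9 8 = m' * homCoeff f 9 8 ∧
    (m : ZMod p) * homCoeff f 8 9 = l' * homCoeff f 8 9 ∧
    (m : ZMod p) * homCoeff f 9 9 = m' * homCoeff f 9 9 := by
  have hmem : ∀ s, ∃ c : Fin 6 → ℤ, f (genC p l m s) = ∑ t, c t • genC p l' m' t := fun s => by
    rw [subC_eq_closure_range, subC_eq_closure_range] at hf
    obtain ⟨c, hc⟩ := AddSubgroup.mem_closure_range_iff_exists_sum.1
      (hf _ (AddSubgroup.subset_closure ⟨s, rfl⟩))
    exact ⟨c, hc.symm⟩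
  have hmem' : ∀ s, ordC s = 1 → ∃ c : Fin 6 → ℤ,
      f (genC p l m s) = ∑ t, c t • p ^ (ordC t - 1) • genC p l' m' t := fun s hs => by
    have hps : p • genC p l m s = 0 := by
      have h3 := (relations_genC hp l m (Pi.single s p)).2 fun t => by
        rcases eq_or_ne t s with rfl | ht
        · simp [hs]
        · simp [ht]
      rw [Finset.sum_eq_single s (fun t _ ht => by simp [ht]) (by simp)] at h3
      simpa using h3
    obtain ⟨c, hc⟩ := hmem s
    rw [hc]
    exact exists_eq_sum_of_smul_eq_zero hp (by decide) (relations_genC hp l' m')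
      (by rw [← hc, ← map_nsmul, hps, map_zero])
  obtain ⟨c0, h0⟩ := hmem 0
  obtain ⟨c1, h1⟩ := hmem 1
  obtain ⟨c2, h2⟩ := hmem 2
  obtain ⟨c3, h3⟩ := hmem 3
  obtain ⟨c4, h4⟩ := hmem' 4 rfl
  obtain ⟨c5, h5⟩ := hmem' 5 rfl
  simp only [genC, CyclicSum.pow_smul_mk] at h0 h1 h2 h3 h4 h5
  have hlow : ∀ i, lowC i < expD i := by decide
  have hlow' : ∀ i, lowC' i < expD i := by decide
  have hpow : ∀ i s, lowC i ≤ powC s i := by decide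
  have hpow' : ∀ i s, lowC' i ≤ powC s i + (ordC s - 1) := by decide
  have e0 := fun i => leading_coeff hp h0 i (lowC i) (hlow i)
    ((by decide : ∀ i j, lowC i ≤ powC 0 j + (expD i - expD j)) i) (hpow i)
  have e1 := fun i => leading_coeff hp h1 i (lowC i) (hlow i)
    ((by decide : ∀ i j, lowC i ≤ powC 1 j + (expD i - expD j)) i) (hpow i)
  have e2 := fun i => leading_coeff hp h2 i (lowC i) (hlow i)
    ((by decide : ∀ i j, lowC i ≤ powC 2 j + (expD i - expD j)) i) (hpow i)
  have e3 := fun i => leading_coeff hp h3 i (lowC i) (hlow i)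
    ((by decide : ∀ i j, lowC i ≤ powC 3 j + (expD i - expD j)) i) (hpow i)
  have e4 := fun i => leading_coeff hp h4 i (lowC' i) (hlow' i)
    ((by decide : ∀ i j, lowC' i ≤ powC 4 j + (expD i - expD j)) i) (hpow' i)
  have e5 := fun i => leading_coeff hp h5 i (lowC' i) (hlow' i)
    ((by decide : ∀ i j, lowC' i ≤ powC 5 j + (expD i - expD j)) i) (hpow' i)
  generalize homCoeff f = F at e0 e1 e2 e3 e4 e5 ⊢
  simp [Fin.forall_fin_ten, Fin.sum_univ_six, Fin.sum_univ_ten, lowC, powC, cofC, expD] at e0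
  simp [Fin.forall_fin_ten, Fin.sum_univ_six, Fin.sum_univ_ten, lowC, powC, cofC, expD] at e1
  simp [Fin.forall_fin_ten, Fin.sum_univ_six, Fin.sum_univ_ten, lowC, powC, cofC, expD] at e2
  simp [Fin.forall_fin_ten, Fin.sum_univ_six, Fin.sum_univ_ten, lowC, powC, cofC, expD] at e3
  simp [Fin.forall_fin_ten, Fin.sum_univ_six, Fin.sum_univ_ten, lowC', powC, cofC, expD, ordC] at e4
  simp [Fin.forall_fin_ten, Fin.sum_univ_six, Fin.sum_univ_ten, lowC', powC, cofC, expD, ordC] at e5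
  obtain ⟨a0, a1, a2, a3, a4, a5, a6, a7, a8, a9⟩ := e0
  obtain ⟨b0, b1, b2, b3, b4, b5, b6, b7, b8, b9⟩ := e1
  obtain ⟨c0, c1, c2, c3, c4, c5, c6, c7, c8, c9⟩ := e2
  obtain ⟨d0, d1, d2, d3, d4, d5, d6, d7, d8, d9⟩ := e3
  obtain ⟨-, -, -, -, g4, g5, g6, g7⟩ := e4
  obtain ⟨-, -, -, -, k4, k5, k6, k7⟩ := e5
  have f66 : (F 6 6 : ZMod p) = F 8 8 := by linear_combination a6 - a8 + a2
  have f76 : (F 7 6 : ZMod p) = F 9 8 := by linear_combination a7 - a9 + a3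
  have f67 : (F 6 7 : ZMod p) = F 8 9 := by linear_combination b6 - b8 + b2
  have f77 : (F 7 7 : ZMod p) = F 9 9 := by linear_combination b7 - b9 + b3
  have f46 : (F 4 6 : ZMod p) = 0 := by linear_combination a4 - a2
  have f56 : (F 5 6 : ZMod p) = 0 := by linear_combination a5 - a3
  have f47 : (F 4 7 : ZMod p) = 0 := by linear_combination b4 - b2
  have f57 : (F 5 7 : ZMod p) = 0 := by linear_combination b5 - b3
  have f22 : (F 2 2 : ZMod p) = F 8 8 := by linear_combination c2 - c8 + c6
  have f32 : (F 3 2 : ZMod p) = F 9 8 := by linear_combination c3 - c9 + c7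
  have f44 : (F 4 4 : ZMod p) = F 8 8 := by linear_combination c4 - c8 + c6
  have f54 : (F 5 4 : ZMod p) = F 9 8 := by linear_combination c5 - c9 + c7
  have f23 : (F 2 3 : ZMod p) = F 8 9 := by linear_combination d2 - d8 + d6
  have f33 : (F 3 3 : ZMod p) = F 9 9 := by linear_combination d3 - d9 + d7
  have f45 : (F 4 5 : ZMod p) = F 8 9 := by linear_combination d4 - d8 + d6
  have f55 : (F 5 5 : ZMod p) = F 9 9 := by linear_combination d5 - d9 + d7
  have f01 : (F 0 1 : ZMod p) = F 8 9 := by linear_combination b0 - b8 + b2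
  have f00 : (F 0 0 + F 8 9 : ZMod p) = F 8 8 := by
    linear_combination a0 - f01 - a8 + a2
  have f11 : (F 1 1 : ZMod p) = F 8 8 + F 9 8 := by
    linear_combination a1 - a8 - a9 + a2 + a3
  have f11' : (F 1 1 : ZMod p) = F 8 9 + F 9 9 := by
    linear_combination b1 - b8 - b9 + b2 + b3
  rw [f44, f46] at g4
  rw [f54, f56] at g5
  rw [f66] at g6
  rw [f76] at g7
  rw [f45, f47] at k4
  rw [f55, f57] at k5
  rw [f67] at k6
  rw [f77] at k7
  refine ⟨fun n88 n98 n89 n99 => ?_, f11.symm.trans f11', by linear_combination g6 - l' * g4,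
    by linear_combination g7 - m' * g5, by linear_combination k6 - l' * k4,
    by linear_combination k7 - m' * k5⟩
  rw [n88, n89, add_zero] at f00
  simp [Fin.forall_fin_ten, expD, f00, f11, f22, f23, f32, f33, f44, f45, f54, f55, f66, f67, f76,
    f77, n88, n89, n98, n99]

end FamilyC
/-! ### Indecomposability and isomorphism of the embeddings -/

section FamilyA

variable {p l l' : ℕ}

theorem isIndecomposableEmbedding_subA (hp : p.Prime) (l : ℕ) :
    IsIndecomposableEmbedding (subA p l) := by
  have := Fact.mk hp
  have key : ∀ f : CyclicSum p expB →+ CyclicSum p expB, f.comp f = f →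
      (∀ a ∈ subA p l, f a ∈ subA p l) → (homCoeff f 4 4 : ZMod p) = 0 → f = 0 := by
    intro f hf hfA h0
    refine CyclicSum.eq_zero_of_comp_self hp (by decide) hf fun i j hij => ?_
    obtain rfl : i = j := (by decide : ∀ i j, expB i = expB j → i = j) i j hij
    rw [(homCoeff_of_map_subA hp hfA).1, h0]
  intro f g hf hg hfg hfA hgA
  have h := homCoeff_comp hp f g (i := 4) (j := 4) rfl (by decide)
  rw [hfg, homCoeff_zero, Finset.sum_eq_single 4 (fun l _ hl => if_neg
    ((by decide : ∀ l, l ≠ 4 → ¬ expB l = expB 4) l hl)) (by simp), if_pos rfl, Nat.cast_zero] at h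
  exact (mul_eq_zero.1 h.symm).imp (key f hf hfA) (key g hg hgA)

theorem eq_of_mulEquiv_subA (hp : p.Prime) (hl : l < p) (hl' : l' < p)
    (φ : EmbGroup (subA p l) ≃* EmbGroup (subA p l')) : l = l' := by
  have := Fact.mk hp
  obtain ⟨f, g, hgf, hf, -⟩ := EmbGroup.exists_homs_of_mulEquiv φ
  have h := homCoeff_comp hp g f (i := 4) (j := 4) rfl (by decide)
  rw [hgf, homCoeff_id hp rfl (by decide), if_pos rfl, Finset.sum_eq_single 4 (fun l _ hl => if_neg
    ((by decide : ∀ l, l ≠ 4 → ¬ expB l = expB 4) l hl)) (by simp), if_pos rfl, Nat.cast_one] at h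
  have hne : (homCoeff f 4 4 : ZMod p) ≠ 0 := right_ne_zero_of_mul (h ▸ one_ne_zero)
  have h1 := mul_right_cancel₀ hne (homCoeff_of_map_subA hp hf).2
  rw [ZMod.natCast_eq_natCast_iff'] at h1
  rwa [Nat.mod_eq_of_lt hl, Nat.mod_eq_of_lt hl'] at h1

theorem exponent_subA (hp : p.Prime) (l : ℕ) : AddMonoid.exponent (subA p l) = p ^ 3 := by
  rw [subA_eq_closure_range]
  exact exponent_closure_of_relations (relations_genA hp l) (by decide) (s₀ := 0) rfl

theorem natCard_embGroup_subA (hp : p.Prime) (l : ℕ) :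
    Nat.card (EmbGroup (subA p l)) = p ^ 31 := by
  have hA : Nat.card (subA p l) = p ^ 7 := by
    rw [subA_eq_closure_range]
    exact natCard_closure_of_relations (relations_genA hp l)
  have hB : Nat.card (CyclicSum p expB) = p ^ 21 := CyclicSum.natCard_eq
  rw [EmbGroup.natCard_eq, exponent_subA hp, hA, hB]
  ring

end FamilyA

section FamilyC

variable {p l m l' m' : ℕ}

/-- The block of leading coefficients at the two generators of order `p` is multiplicative. -/
theorem homCoeff_comp_expD (hp : p.Prime) (f g : CyclicSum p expD →+ CyclicSum p expD)
    {i j : Fin 10} (hi : expD i = 1) (hj : expD j = 1) :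
    (homCoeff (f.comp g) i j : ZMod p) =
      homCoeff f i 8 * homCoeff g 8 j + homCoeff f i 9 * homCoeff g 9 j := by
  rw [homCoeff_comp hp f g (hi.trans hj.symm) (by omega), hi, Fin.sum_univ_ten]
  generalize homCoeff f = F
  generalize homCoeff g = G
  simp [expD]

/-- For `l ≠ m` modulo `p`, the `2 × 2`-block of an endomorphism of `C_{l,m} ⊆ D` commutes with
`diag(l, m)`, so it is diagonal, and then it is scalar. -/
theorem homCoeff_of_map_subC_self (hp : p.Prime) (hlm : l < m) (hm : m < p)
    {f : CyclicSum p expD →+ CyclicSum p expD} (hf : ∀ a ∈ subC p l m, f a ∈ subC p l m) :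
    (homCoeff f 9 8 : ZMod p) = 0 ∧ (homCoeff f 8 9 : ZMod p) = 0 ∧
      (homCoeff f 9 9 : ZMod p) = homCoeff f 8 8 := by
  have := Fact.mk hp
  have hne : (l : ZMod p) ≠ m := fun h => by
    rw [ZMod.natCast_eq_natCast_iff', Nat.mod_eq_of_lt (hlm.trans hm), Nat.mod_eq_of_lt hm] at h
    exact hlm.ne h
  obtain ⟨-, h1, -, h2, h3, -⟩ := homCoeff_of_map_subC hp hf
  have h98 : (homCoeff f 9 8 : ZMod p) = 0 := (mul_eq_mul_right_iff.1 h2).resolve_left hne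
  have h89 : (homCoeff f 8 9 : ZMod p) = 0 := (mul_eq_mul_right_iff.1 h3).resolve_left hne.symm
  exact ⟨h98, h89, by linear_combination h98 - h89 - h1⟩

theorem isIndecomposableEmbedding_subC (hp : p.Prime) (hlm : l < m) (hm : m < p) :
    IsIndecomposableEmbedding (subC p l m) := by
  have := Fact.mk hp
  have key : ∀ f : CyclicSum p expD →+ CyclicSum p expD, f.comp f = f →
      (∀ a ∈ subC p l m, f a ∈ subC p l m) → (homCoeff f 8 8 : ZMod p) = 0 → f = 0 := by
    intro f hf hfA h0
    obtain ⟨h1, h2, h3⟩ := homCoeff_of_map_subC_self hp hlm hm hfA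
    exact CyclicSum.eq_zero_of_comp_self hp (by decide) hf
      ((homCoeff_of_map_subC hp hfA).1 h0 h1 h2 (h3.trans h0))
  intro f g hf hg hfg hfA hgA
  have h := homCoeff_comp_expD hp f g (i := 8) (j := 8) rfl rfl
  rw [hfg, homCoeff_zero, (homCoeff_of_map_subC_self hp hlm hm hfA).2.1, zero_mul, add_zero,
    Nat.cast_zero] at h
  exact (mul_eq_zero.1 h.symm).imp (key f hf hfA) (key g hg hgA)

/-- The invertible `2 × 2`-block of an isomorphism conjugates `diag(l, m)` to `diag(l', m')`, so the
unordered pairs of eigenvalues coincide. -/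
theorem eq_of_mulEquiv_subC (hp : p.Prime) (hlm : l < m) (hm : m < p) (hlm' : l' < m')
    (hm' : m' < p) (φ : EmbGroup (subC p l m) ≃* EmbGroup (subC p l' m')) : l = l' ∧ m = m' := by
  have := Fact.mk hp
  obtain ⟨f, g, hgf, hf, -⟩ := EmbGroup.exists_homs_of_mulEquiv φ
  have hid : ∀ i j, expD i = 1 → expD j = 1 → (homCoeff g i 8 * homCoeff f 8 j +
      homCoeff g i 9 * homCoeff f 9 j : ZMod p) = if i = j then 1 else 0 := fun i j hi hj => by
    rw [← homCoeff_comp_expD hp g f hi hj, hgf, homCoeff_id hp (hi.trans hj.symm) (by omega),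
      Nat.cast_ite, Nat.cast_one, Nat.cast_zero]
  have h88 := hid 8 8 rfl rfl
  have h89 := hid 8 9 rfl rfl
  have h98 := hid 9 8 rfl rfl
  have h99 := hid 9 9 rfl rfl
  rw [if_pos rfl] at h88 h99
  rw [if_neg (by decide)] at h89 h98
  have cancel : ∀ {a b : ℕ} {x : ZMod p}, a < p → b < p → (a : ZMod p) * x = b * x → x ≠ 0 →
      a = b := by
    intro a b x ha hb h hx
    have h1 := mul_right_cancel₀ hx h
    rwa [ZMod.natCast_eq_natCast_iff', Nat.mod_eq_of_lt ha, Nat.mod_eq_of_lt hb] at h1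
  have hl : l < p := hlm.trans hm
  have hl' : l' < p := hlm'.trans hm'
  obtain ⟨-, -, e1, e2, e3, e4⟩ := homCoeff_of_map_subC hp hf
  have c1 := cancel hl hl' e1
  have c2 := cancel hl hm' e2
  have c3 := cancel hm hl' e3
  have c4 := cancel hm hm' e4
  -- As the determinant is nonzero, both diagonal entries or both others are nonzero; the second case
  -- would give `l = m'` and `m = l'`, against the order of the pairs.
  have hdet : (homCoeff f 8 8 : ZMod p) * homCoeff f 9 9 - homCoeff f 8 9 * homCoeff f 9 8 ≠ 0 := by
    refine right_ne_zero_of_mul (a := (homCoeff g 8 8 : ZMod p) * homCoeff g 9 9 -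
      homCoeff g 8 9 * homCoeff g 9 8) ?_
    refine ne_of_eq_of_ne ?_ one_ne_zero
    linear_combination
      (homCoeff g 9 8 * homCoeff f 8 9 + homCoeff g 9 9 * homCoeff f 9 9 : ZMod p) * h88 + h99 -
        (homCoeff g 9 8 * homCoeff f 8 8 + homCoeff g 9 9 * homCoeff f 9 8 : ZMod p) * h89
  by_cases hdiag : (homCoeff f 8 8 : ZMod p) * homCoeff f 9 9 = 0
  · rw [hdiag, zero_sub, neg_ne_zero] at hdet
    have := c2 (right_ne_zero_of_mul hdet)
    have := c3 (left_ne_zero_of_mul hdet)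
    omega
  · exact ⟨c1 (left_ne_zero_of_mul hdiag), c4 (right_ne_zero_of_mul hdiag)⟩

theorem exponent_subC (hp : p.Prime) (l m : ℕ) : AddMonoid.exponent (subC p l m) = p ^ 3 := by
  rw [subC_eq_closure_range]
  exact exponent_closure_of_relations (relations_genC hp l m) (by decide) (s₀ := 0) rfl

theorem natCard_embGroup_subC (hp : p.Prime) (l m : ℕ) :
    Nat.card (EmbGroup (subC p l m)) = p ^ 60 := by
  have hC : Nat.card (subC p l m) = p ^ 14 := by
    rw [subC_eq_closure_range]
    exact natCard_closure_of_relations (relations_genC hp l m)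
  have hD : Nat.card (CyclicSum p expD) = p ^ 43 := CyclicSum.natCard_eq
  rw [EmbGroup.natCard_eq, exponent_subC hp, hC, hD]
  ring

end FamilyC

/-! ### The exponent of the groups and the number of pairs -/

/-- One factor `p` is given away here because it is lost for `p = 2`. -/
theorem Nat.Prime.pow_dvd_choose_two {p : ℕ} (hp : p.Prime) (n : ℕ) :
    p ^ n ∣ (p ^ (n + 1)).choose 2 := by
  have h : (p ^ (n + 1)).choose 2 * 2 = p ^ (n + 1) * (p ^ (n + 1) - 1) := by
    rw [Nat.choose_two_right, Nat.div_mul_cancel (Nat.even_mul_pred_self _).two_dvd]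
  rcases hp.eq_two_or_odd' with rfl | hodd
  · refine ⟨2 ^ (n + 1) - 1, ?_⟩
    rw [pow_succ 2 n, mul_right_comm] at h
    rw [pow_succ]
    exact Nat.eq_of_mul_eq_mul_right two_pos h
  · refine (pow_dvd_pow p n.le_succ).trans ?_
    exact (Nat.Coprime.pow_left (n + 1) hodd.coprime_two_right).dvd_of_dvd_mul_right ⟨_, h⟩

theorem exponent_embGroup {p k n : ℕ} (hp : p.Prime) {e : Fin k → ℕ}
    {A : AddSubgroup (CyclicSum p e)} (hA : AddMonoid.exponent A = p ^ 3) (hn : 3 ≤ n)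
    (he : ∀ i, e i ≤ n + 1) {i : Fin k} (hi : e i = n + 1) :
    Monoid.exponent (EmbGroup A) = p ^ (n + 1) :=
  EmbGroup.exponent_eq (CyclicSum.exponent_eq he hi) (hA ▸ pow_dvd_pow p (by omega))
    (hA ▸ (pow_dvd_pow p hn).trans (hp.pow_dvd_choose_two n))

/-- The pairs `l < m < p` are counted by the two-element subsets of `{0, …, p - 1}`. -/
theorem exists_pairs (p : ℕ) : ∃ a b : Fin (p.choose 2) → ℕ,
    (∀ i, a i < b i ∧ b i < p) ∧ ∀ i j, a i = a j → b i = b j → i = j := by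
  have hcard : Fintype.card (Finset.powersetCard 2 (Finset.range p)) = p.choose 2 := by
    rw [Fintype.card_coe, Finset.card_powersetCard, Finset.card_range]
  let E := (Fintype.equivFinOfCardEq hcard).symm
  have h : ∀ i, ∃ x : ℕ × ℕ, (x.1 < x.2 ∧ x.2 < p) ∧ (E i : Finset ℕ) = {x.1, x.2} := by
    intro i
    obtain ⟨hsub, hc⟩ := Finset.mem_powersetCard.1 (E i).2
    obtain ⟨x, y, hxy, hE⟩ := Finset.card_eq_two.1 hc
    have hx : x < p := Finset.mem_range.1 (hsub (by simp [hE]))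
    have hy : y < p := Finset.mem_range.1 (hsub (by simp [hE]))
    rcases lt_or_gt_of_ne hxy with h | h
    · exact ⟨(x, y), ⟨h, hy⟩, hE⟩
    · exact ⟨(y, x), ⟨h, hx⟩, hE.trans (Finset.pair_comm _ _)⟩
  choose x hx hE using h
  refine ⟨fun i => (x i).1, fun i => (x i).2, hx, fun i j h1 h2 => ?_⟩
  apply E.injective
  apply Subtype.ext
  rw [hE, hE, show x i = x j from Prod.ext h1 h2]

theorem theorem5 (p : ℕ) (hp : p.Prime) :
    AtLeastNonisomorphic p (fun M _ =>
      IsBirkhoffMetabelian M ∧ IsIndecomposableGroup M ∧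
      Nat.card M = p ^ 31 ∧ Monoid.exponent M = p ^ 7 ∧
      Monoid.exponent (commutator M) = p ^ 3 ∧
      ∃ l : ℕ, l < p ∧ IsEmbeddingObject p 7 (subA p l) ∧
        Nonempty (M ≃* EmbGroup (subA p l))) ∧
    AtLeastNonisomorphic (p.choose 2) (fun M _ =>
      IsBirkhoffMetabelian M ∧ IsIndecomposableGroup M ∧
      Nat.card M = p ^ 60 ∧ Monoid.exponent M = p ^ 8 ∧
      Monoid.exponent (commutator M) = p ^ 3 ∧
      ∃ l m : ℕ, l < m ∧ m < p ∧ IsEmbeddingObject p 8 (subC p l m) ∧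
        Nonempty (M ≃* EmbGroup (subC p l m))) := by
  constructor
  · have : Nontrivial (CyclicSum p expB) := by
      have : Fact (1 < p ^ expB 0) := ⟨Nat.one_lt_pow (by decide) hp.one_lt⟩
      exact Pi.nontrivial_at 0
    refine ⟨fun l => EmbGroup (subA p l), fun l => inferInstance, fun l => ?_, fun l l' h => ?_⟩
    · have hA := exponent_subA hp l
      exact ⟨EmbGroup.isBirkhoffMetabelian _,
        EmbGroup.isIndecomposable (isIndecomposableEmbedding_subA hp l),
        natCard_embGroup_subA hp l,
        exponent_embGroup hp hA (n := 6) (by decide) (by decide) (i := 0) rfl,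
        (EmbGroup.exponent_commutator _).trans hA, l, l.2,
        ⟨CyclicSum.finite hp, CyclicSum.pow_smul_eq_zero (by decide)⟩, ⟨MulEquiv.refl _⟩⟩
    · exact ⟨fun φ => h (Fin.ext (eq_of_mulEquiv_subA hp l.2 l'.2 φ))⟩
  · have : Nontrivial (CyclicSum p expD) := by
      have : Fact (1 < p ^ expD 0) := ⟨Nat.one_lt_pow (by decide) hp.one_lt⟩
      exact Pi.nontrivial_at 0
    obtain ⟨a, b, hab, hinj⟩ := exists_pairs p
    refine ⟨fun i => EmbGroup (subC p (a i) (b i)), fun i => inferInstance, fun i => ?_,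
      fun i j h => ?_⟩
    · have hC := exponent_subC hp (a i) (b i)
      exact ⟨EmbGroup.isBirkhoffMetabelian _,
        EmbGroup.isIndecomposable (isIndecomposableEmbedding_subC hp (hab i).1 (hab i).2),
        natCard_embGroup_subC hp _ _,
        exponent_embGroup hp hC (n := 7) (by decide) (by decide) (i := 0) rfl,
        (EmbGroup.exponent_commutator _).trans hC, a i, b i, (hab i).1, (hab i).2,
        ⟨CyclicSum.finite hp, CyclicSum.pow_smul_eq_zero (by decide)⟩, ⟨MulEquiv.refl _⟩⟩
    · refine ⟨fun φ => h ?_⟩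
      obtain ⟨h1, h2⟩ := eq_of_mulEquiv_subC hp (hab i).1 (hab i).2 (hab j).1 (hab j).2 φ
      exact hinj i j h1 h2
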